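/- **Setting.** Let $G=(V,E)$ be a connected plane (multi)graph with $n=|V|$ vertices, with costs $\mathrm{cost}(\{s,t\})\ge 0$ on the edges and demands $\mathrm{demand}(\{s,t\})\ge 0$ on the pairs of vertices. For $U\subseteq V$ let $\mathrm{cost}(U)$ be the total cost of the edges with exactly one end in $U$, let $\mathrm{demand}(U)$ be the total demand of the pairs with exactly one member in $U$, and let $\mathrm{cost}(U)/\mathrm{demand}(U)$ be the sparsity of $U$. Let $\Phi^*$ be the minimum sparsity over all $U$ with $\mathrm{demand}(U)>0$. Demands are normalized: if $\mathrm{demand}(U)>0$ then $1\le \mathrm{demand}(U)\le n^5$. Let $G^*=(V^*,E^*)$ be the planar dual; its faces are the vertices of $G$, and we assume that every face of $G^*$ has at least two distinct vertices on its boundary. For a simple cycle $C$ of $G^*$ let $\mathsf{inside}(C)$ be the set of faces of $G^*$ inside $C$; the sparsity and the separated demand of $C$ are those of $\mathsf{inside}(C)$. **Decompositions.** A *nondeterministic hierarchical decomposition* $\mathcal T$ of $V^*$ is a finite rooted tree in which partition nodes and cluster nodes alternate. A cluster node $c$ carries a nonempty set $K(c)\subseteq V^*$. A partition node $p$ with parent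 $c$ carries a partition $\pi(p)$ of $K(c)$, and its children are cluster nodes, one for each part of $\pi(p)$. The root $\widehat p$ is a partition node with $\pi(\widehat p)=\{V^*\}$, and all leaves are cluster nodes with $|K(c)|=1$. Some partition nodes may be designated *shattering*; the others are *normal*. A cycle $C$ is *$Z$-amenable* for $p$ if at most $Z$ edges of $C$ (none, if $p$ is shattering) have their ends in different parts of $\pi(p)$. A *forcing* $\varphi$ chooses a child of each non-leaf cluster node; a partition node is *relevant* under $\varphi$ if it and all its ancestor partition nodes other than the root are the choices of their parents. $\mathcal T$ is *$(Z,\varepsilon)$-friendly* if there are a forcing $\varphi$ and a simple cycle $C$ of $G^*$ that separates positive demand, has sparsity at most $(1+\varepsilon)\Phi^*$, and is $Z$-amenable for all relevant partition nodes. **Notation.** For a partition $\pi$ of a subset of $V^*$, $\partial(\pi)$ is the set of faces of $G^*$ whose vertices all lie in that subset but in more than one part. Let $\mathsf{path}(p)$ be the set of partition nodes on the path from the root to $p$, inclusive. Let $\pi^+(p)$ be the partition of $V^*$ consisting of the parts of $\pi(p)$ and of those parts of $\pi(p')$, $p'\in\mathsf{path}(p)$, that do not contain $K(c)$, where $c$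 is the parent of $p$ (and $\pi^+(\widehat p)=\{V^*\}$). Put $\partial(p)=\partial(\pi(p))$, $\partial^+(p)=\partial(\pi^+(p))$, and $$\mathcal A^+(p)=\{\mathsf{inside}(C)\cap\partial^+(p) : C \text{ a simple cycle of } G^*,\ Z\text{-amenable for all } p'\in\mathsf{path}(p)\}.$$ For $p\neq p'$ put $\partial^+(\{p,p'\})=\partial^+(p)\cup\partial^+(p')$ and $\mathcal A^+(\{p,p'\})=\{S\cup S' : S\in\mathcal A^+(p),S'\in\mathcal A^+(p')\}$; also $\partial^+(\{p\})=\partial^+(p)$ and $\mathcal A^+(\{p\})=\mathcal A^+(p)$. For a face $s$ let $\mathcal S(p,s)$ be the set of nodes $p_s$ with $s\in\partial(p_s)$ that are $p$ or a descendant of $p$. For faces $s\ne t$ let $\mathcal S(p,\{s,t\})$ be the collection of sets $\{p_s,p_t\}$ (possibly $p_s=p_t$) with $s\in\partial(p_s)$, $t\in\partial(p_t)$ whose lowest common ancestor is $p$. **The linear program $\mathrm{LP}(\alpha)$.** The variables are $x(\{p\},S)$ for $S\in\mathcal A^+(p)$; $x(\{p,p'\},S)$ for $S\in\mathcal A^+(\{p,p'\})$,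 for $p\ne p'$ whose lowest common ancestor is a partition node; $z(p,s,D,W)$ for $D\subseteq\{s\}$, $W\in\mathcal A^+(p)$; $y(p,\{s,t\},D,W)$ for $s\neq t$, $D\subseteq\{s,t\}$, $W\in\mathcal A^+(p)$; and $y(\{s,t\})$ for $s\ne t$. The constraints are: 1. $0\le x\le 1$ for all $x$-variables, and $x(\{\widehat p\},\emptyset)=1$; 2. $x(\{p\},S)=\sum_i\sum_{S'\in\mathcal A^+(p_i),\,S'\cap\partial^+(p)=S}x(\{p_i\},S')$ for each non-leaf cluster node with parent $p$ and children $p_i$, and each $S\in\mathcal A^+(p)$; 3. $z(p,s,D,W)=\sum x(\{p_s\},S)$ over $p_s\in\mathcal S(p,s)$ and $S\in\mathcal A^+(p_s)$ with $S\cap\{s\}=D$, $S\cap\partial^+(p)=W$; 4. $y(p,\{s,t\},D,W)=\sum x(\{p_s,p_t\},S)$ over $\{p_s,p_t\}\in\mathcal S(p,\{s,t\})$ and $S\in\mathcal A^+(\{p_s,p_t\})$ with $S\cap\{s,t\}=D$, $S\cap\partial^+(p)=W$; 5. if $\mathcal S(p,\{s,t\})\neq\emptyset$: $z(p,s,D,W)=\sum_{D'\subseteq\{s,t\},\,D'\cap\{s\}=D}y(p,\{s,t\},D',W)$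 for $D\subseteq\{s\}$, $W\in\mathcal A^+(p)$; 6. $y(\{s,t\})=\sum_p\sum_{D\subseteq\{s,t\},\,|D|=1}\sum_{W\in\mathcal A^+(p)}y(p,\{s,t\},D,W)$; 7. if $\mathcal S(p,\{s,t\})\neq\emptyset$: $x(\{p\},W)=\sum x(\{p_s,p_t\},S)$ over $\{p_s,p_t\}\in\mathcal S(p,\{s,t\})$ and $S\in\mathcal A^+(\{p_s,p_t\})$ with $S\cap\partial^+(p)=W$, for each $W\in\mathcal A^+(p)$; 8. $\sum_{\{s,t\}}\mathrm{demand}(\{s,t\})\,y(\{s,t\})\ge\alpha$. The objective (fractional cost) is $\sum_{\{s,t\}\in E}\mathrm{cost}(\{s,t\})\,y(\{s,t\})$. **Lemma.** There is an absolute constant $K$ such that the following holds for $0<\varepsilon\le1$ and every $(Z,\varepsilon)$-friendly nondeterministic hierarchical decomposition $\mathcal T$. There are at most $K\varepsilon^{-1}\log n$ powers $\alpha=(1+\varepsilon)^i$, $i \ge 0$, in $[1,n^5]$. For at least one of them there are a forcing $\varphi$ and a simple cycle $C$ of $G^*$ that separates positive demand, has sparsity at most $(1+\varepsilon)\Phi^*$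 and is $Z$-amenable for all partition nodes relevant under $\varphi$, such that the following 0-1 encoding of $U=\mathsf{inside}(C)$ and $\varphi$ is a feasible solution of $\mathrm{LP}(\alpha)$ of fractional cost at most $(1+K\varepsilon)\,\alpha\,\Phi^*$: - $x(q,S)=1$ iff all $p\in q$ are relevant and $U\cap\partial^+(q)=S$; - $z(p,s,D,W)=1$ iff $p$ is relevant, $\mathcal S(p,s)\ne\emptyset$, $U\cap\{s\}=D$ and $U\cap\partial^+(p)=W$; - $y(p,\{s,t\},D,W)=1$ iff $p$ is relevant, $\mathcal S(p,\{s,t\})\ne\emptyset$, $U\cap\{s,t\}=D$ and $U\cap\partial^+(p)=W$; - $y(\{s,t\})=1$ iff $|U\cap\{s,t\}|=1$; and all other values are $0$. -/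

import Mathlib

universe u

namespace PlanarSparsestCut

noncomputable section

open scoped Classical

/-- A connected plane multigraph `G`, presented by its rotation system. Each edge consists of two
darts exchanged by `rev`; `rot` turns each dart to the next dart around its tail `vert d`;
`face d` is the face on a fixed side of `d`. Thus the vertices `V` are the cycles of `rot`, the faces
`F` are the cycles of `rot * rev`, and genus zero is Euler's formula `|V| - |D| / 2 + |F| = 2`.

The planar dual `G*` has vertex set `F`; the edge of `{d, rev d}` joins `face d` to `face (rev d)`;
the faces of `G*` are the elements of `V`, and `outer` is the unbounded one. -/
structure PlaneGraph (D V F : Type u) [Fintype D] [Fintype V] [Fintype F] where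
  rev : Equiv.Perm D
  rot : Equiv.Perm D
  vert : D → V
  face : D → F
  outer : V
  rev_rev : ∀ d, rev (rev d) = d
  rev_ne : ∀ d, rev d ≠ d
  vert_surjective : Function.Surjective vert
  face_surjective : Function.Surjective face
  vert_eq_iff : ∀ d d', vert d = vert d' ↔ rot.SameCycle d d'
  face_eq_iff : ∀ d d', face d = face d' ↔ (rot * rev).SameCycle d d'
  connected : ∀ a b, Relation.ReflTransGen (fun v w => ∃ d, vert d = v ∧ vert (rev d) = w) a b
  euler : 2 * (Fintype.card V + Fintype.card F) = Fintype.card D + 4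

section Graph

variable {D V F : Type u} [Fintype D] [Fintype V] [Fintype F]

namespace PlaneGraph

variable (G : PlaneGraph D V F)

/-- The dual vertices on the boundary of the dual face `s`. -/
def faceVerts (s : V) : Finset F :=
  Finset.univ.filter fun f => ∃ d, G.vert d = s ∧ G.face d = f

/-- `e = {s, t}` for two distinct dual faces `s`, `t` that share a dual edge, that is, two distinct
endpoints of an edge of `G`. -/
def IsEdge (e : Finset V) : Prop :=
  e.card = 2 ∧ ∃ d, e = {G.vert d, G.vert (G.rev d)}

/-- A simple cycle in the dual graph `G*`: a cyclic sequence of darts, each ending in the dual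
vertex where the next one starts, with pairwise distinct dual vertices and dual edges. -/
structure DualCycle where
  len : ℕ
  len_pos : 0 < len
  dart : Fin len → D
  next : ∀ i, G.face (G.rev (dart i)) = G.face (dart (finRotate len i))
  simple : Function.Injective fun i => G.face (dart i)
  edges_distinct : ∀ i j, dart i ≠ G.rev (dart j)

variable {G}

/-- The dual faces inside `C`: those which cannot be reached from the unbounded dual face by
passing from face to face across dual edges that are not on `C`. -/
def DualCycle.inside (C : G.DualCycle) : Finset V :=
  Finset.univ.filter fun v => ¬ Relation.ReflTransGen
    (fun a b => ∃ d, G.vert d = a ∧ G.vert (G.rev d) = b ∧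
      ∀ i, C.dart i ≠ d ∧ C.dart i ≠ G.rev d) G.outer v

end PlaneGraph

/-- Edge costs and demands. Both are functions of unordered pairs `{s, t}` of vertices of `G`; only
the costs of edges and the demands of two-element sets are ever used. -/
structure CutInstance (V : Type u) where
  cost : Finset V → ℝ
  demand : Finset V → ℝ
  cost_nonneg : ∀ e, 0 ≤ cost e
  demand_nonneg : ∀ e, 0 ≤ demand e

namespace CutInstance

variable (I : CutInstance V) (G : PlaneGraph D V F)

/-- The total cost of the edges of `G` with exactly one endpoint in `U`. -/
def cutCost (U : Finset V) : ℝ :=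
  ∑ e : Finset V with G.IsEdge e ∧ (U ∩ e).card = 1, I.cost e

/-- The total demand of the pairs separated by `U`. -/
def cutDemand (U : Finset V) : ℝ :=
  ∑ e : Finset V with e.card = 2 ∧ (U ∩ e).card = 1, I.demand e

def sparsity (U : Finset V) : ℝ := I.cutCost G U / I.cutDemand U

/-- The optimal sparsity `Φ*`, over all cuts that separate some demand. -/
def optSparsity : ℝ := sInf {r | ∃ U : Finset V, 0 < I.cutDemand U ∧ r = I.sparsity G U}

/-- The normalization of the demands: each cut that separates some demand separates at least `1`
and at most `n ^ 5`. -/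
def Normalized : Prop :=
  ∀ U : Finset V, 0 < I.cutDemand U →
    1 ≤ I.cutDemand U ∧ I.cutDemand U ≤ (Fintype.card V : ℝ) ^ 5

end CutInstance

end Graph

/-- A nondeterministic hierarchical decomposition of a vertex set `F`: a rooted tree in which
partition nodes `P` and cluster nodes `Q` alternate. The root is a partition node, carrying the
trivial partition `{F}`. The cluster nodes below a partition node `p` are in bijection, through `K`,
with the parts of the partition `π(p)`, which is a partition of the cluster of the parent of `p`.
A cluster node may have several child partition nodes (the alternatives for partitioning it),
and leaves are singleton clusters. Some partition nodes may be designated as shattering, the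
others are normal. -/
structure Decomposition (P Q F : Type u) [Fintype P] [Fintype Q] [Fintype F] where
  root : P
  parentP : P → Option Q
  parentQ : Q → P
  K : Q → Finset F
  shattering : P → Prop
  parentP_eq_none : ∀ p, parentP p = none ↔ p = root
  reach_root : ∀ p, Relation.ReflTransGen
    (fun a b => ∃ c, parentQ c = a ∧ parentP b = some c) root p
  K_nonempty : ∀ c, (K c).Nonempty
  K_root : ∀ c, parentQ c = root → K c = Finset.univ
  K_disjoint : ∀ c c', parentQ c = parentQ c' → c ≠ c' → Disjoint (K c) (K c')
  K_cover : ∀ p f, (∃ c, parentQ c = p ∧ f ∈ K c) ↔ ∀ c, parentP p = some c → f ∈ K c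
  leaf_singleton : ∀ c, (∀ p, parentP p ≠ some c) → (K c).card = 1

/-- The variables of the linear program: `x q S` is `x({p}, S)` for `q = {p}` and
`x({p, p'}, S)` for `q = {p, p'}`; `z p s D W` is `z(p, s, D, W)`; `y p {s, t} D W` is
`y(p, {s, t}, D, W)`; and `ysep {s, t}` is `y({s, t})`. -/
structure LPVars (P V : Type u) where
  x : Finset P → Finset V → ℝ
  z : P → V → Finset V → Finset V → ℝ
  y : P → Finset V → Finset V → Finset V → ℝ
  ysep : Finset V → ℝ

namespace Decomposition

variable {D V F P Q : Type u} [Fintype D] [Fintype V] [Fintype F] [Fintype P] [Fintype Q]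
variable (T : Decomposition P Q F)

/-- `a` is the parent of `b` in the tree. -/
def IsParent : P ⊕ Q → P ⊕ Q → Prop
  | Sum.inr c, Sum.inl p => T.parentP p = some c
  | Sum.inl p, Sum.inr c => T.parentQ c = p
  | _, _ => False

/-- `a` is `b` or an ancestor of `b`. -/
def Anc (a b : P ⊕ Q) : Prop := Relation.ReflTransGen T.IsParent a b

/-- `m` is the lowest common ancestor of `a` and `b`. -/
def IsLCA (a b m : P ⊕ Q) : Prop :=
  T.Anc m a ∧ T.Anc m b ∧ ∀ m', T.Anc m' a → T.Anc m' b → T.Anc m' m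

/-- The partition nodes on the path from the root to `p`, inclusive. -/
def partnPath (p : P) : Finset P :=
  Finset.univ.filter fun p' => T.Anc (Sum.inl p') (Sum.inl p)

/-- The vertex set that is partitioned at `p`: the cluster of the parent of `p`, or everything if
`p` is the root. -/
def ground (p : P) : Finset F := (T.parentP p).elim Finset.univ T.K

/-- The partition `π(p)`, as the set of its parts. -/
def parts (p : P) : Finset (Finset F) :=
  (Finset.univ.filter fun c => T.parentQ c = p).image T.K

/-- The partition `π⁺(p)` of all of `F`. -/
def partsPlus (p : P) : Finset (Finset F) :=
  T.parts p ∪ ((T.partnPath p).biUnion T.parts).filter fun A => ¬ T.ground p ⊆ A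

/-- A forcing chooses a child partition node for each non-leaf cluster node (its values at leaves are
irrelevant). -/
def IsForcing (φ : Q → P) : Prop :=
  ∀ c, (∃ p, T.parentP p = some c) → T.parentP (φ c) = some c

/-- A partition node is relevant if every partition node on its path from the root is the one chosen
by its parent cluster node. The relevant nodes form the forced tree. -/
def Relevant (φ : Q → P) (p : P) : Prop :=
  ∀ p' ∈ T.partnPath p, ∀ c, T.parentP p' = some c → φ c = p'

variable (G : PlaneGraph D V F)

/-- The boundary of a partition of a set of dual vertices: the dual faces all of whose vertices lie
in the partitioned set, but in more than one part. -/
def _root_.PlanarSparsestCut.boundary (π : Finset (Finset F)) : Finset V :=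
  Finset.univ.filter fun s =>
    (∀ f ∈ G.faceVerts s, ∃ A ∈ π, f ∈ A) ∧
    ∃ A ∈ π, ∃ B ∈ π, A ≠ B ∧ (∃ f ∈ G.faceVerts s, f ∈ A) ∧ ∃ f ∈ G.faceVerts s, f ∈ B

/-- `∂(p)` -/
def bd (p : P) : Finset V := boundary G (T.parts p)

/-- `∂⁺(p)` -/
def bdPlus (p : P) : Finset V := boundary G (T.partsPlus p)

/-- `∂⁺({p})` and `∂⁺({p, p'})`. -/
def bdPlusSet (q : Finset P) : Finset V := q.biUnion (T.bdPlus G)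

variable {G}

/-- The number of edges of `C` whose ends lie in different parts of `π(p)`. -/
def crossings (C : G.DualCycle) (p : P) : ℕ :=
  (Finset.univ.filter fun i => ∃ A ∈ T.parts p, ∃ B ∈ T.parts p, A ≠ B ∧
    G.face (C.dart i) ∈ A ∧ G.face (G.rev (C.dart i)) ∈ B).card

/-- `C` is `Z`-amenable for `p`: it crosses `π(p)` at most `Z` times, and not at all if `p` is
shattering. -/
def Amenable (Z : ℕ) (C : G.DualCycle) (p : P) : Prop :=
  T.crossings C p ≤ Z ∧ (T.shattering p → T.crossings C p = 0)

/-- `C` is `Z`-amenable for the tree forced by `φ`. -/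
def AmenableForced (Z : ℕ) (φ : Q → P) (C : G.DualCycle) : Prop :=
  ∀ p, T.Relevant φ p → T.Amenable Z C p

/-- `φ` is a forcing and `C` is a cut of sparsity at most `(1 + ε) Φ*` that is `Z`-amenable for the
forced tree. -/
def IsFriendlyPair (I : CutInstance V) (Z : ℕ) (ε : ℝ) (φ : Q → P) (C : G.DualCycle) : Prop :=
  T.IsForcing φ ∧ 0 < I.cutDemand C.inside ∧
    I.sparsity G C.inside ≤ (1 + ε) * I.optSparsity G ∧ T.AmenableForced Z φ C

variable (G)

/-- `T` is `(Z, ε)`-friendly. -/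
def Friendly (I : CutInstance V) (Z : ℕ) (ε : ℝ) : Prop :=
  ∃ (φ : Q → P) (C : G.DualCycle), T.IsFriendlyPair I Z ε φ C

/-- `𝒜⁺(p)` -/
def APlus (Z : ℕ) (p : P) : Set (Finset V) :=
  {S | ∃ C : G.DualCycle, (∀ p' ∈ T.partnPath p, T.Amenable Z C p') ∧ S = C.inside ∩ T.bdPlus G p}

/-- `𝒜⁺({p})`, which is `𝒜⁺(p)`, and `𝒜⁺({p, p'})`, which consists of the unions of a member of
`𝒜⁺(p)` and a member of `𝒜⁺(p')`. -/
def APlusSet (Z : ℕ) (q : Finset P) : Set (Finset V) :=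
  {S | ∃ A : P → Finset V, (∀ p ∈ q, A p ∈ T.APlus G Z p) ∧ S = q.biUnion A}

/-- `𝒮(p, s)` -/
def nodesOf (p : P) (s : V) : Finset P :=
  Finset.univ.filter fun ps => T.Anc (Sum.inl p) (Sum.inl ps) ∧ s ∈ T.bd G ps

/-- `𝒮(p, {s, t})` -/
def pairsOf (p : P) (s t : V) : Finset (Finset P) :=
  Finset.univ.filter fun q => ∃ ps pt, q = {ps, pt} ∧ s ∈ T.bd G ps ∧ t ∈ T.bd G pt ∧
    T.IsLCA (Sum.inl ps) (Sum.inl pt) (Sum.inl p)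

/-- The constraints of the linear program for the guess `α` of the separated demand.
Constraints and variables with `𝒮(p, s) = ∅` or `𝒮(p, {s, t}) = ∅` are void: there the sums that
define `z` and `y` are empty, and the constraints `marginals` and `lift` are not imposed. -/
structure LPFeasible (I : CutInstance V) (Z : ℕ) (α : ℝ) (v : LPVars P V) : Prop where
  x_single : ∀ p, ∀ S ∈ T.APlus G Z p, 0 ≤ v.x {p} S ∧ v.x {p} S ≤ 1
  x_pair : ∀ p p' m, p ≠ p' → T.IsLCA (Sum.inl p) (Sum.inl p') (Sum.inl m) →
    ∀ S ∈ T.APlusSet G Z {p, p'}, 0 ≤ v.x {p, p'} S ∧ v.x {p, p'} S ≤ 1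
  root : v.x {T.root} ∅ = 1
  assign : ∀ c, (∃ p, T.parentP p = some c) → ∀ S ∈ T.APlus G Z (T.parentQ c),
    v.x {T.parentQ c} S =
      ∑ p : P with T.parentP p = some c,
        ∑ S' : Finset V with S' ∈ T.APlus G Z p ∧ S' ∩ T.bdPlus G (T.parentQ c) = S, v.x {p} S'
  proj_z : ∀ p s, ∀ D ⊆ {s}, ∀ W ∈ T.APlus G Z p,
    v.z p s D W =
      ∑ ps ∈ T.nodesOf G p s,
        ∑ S : Finset V with S ∈ T.APlus G Z ps ∧ S ∩ {s} = D ∧ S ∩ T.bdPlus G p = W, v.x {ps} S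
  proj_y : ∀ p s t, s ≠ t → ∀ D ⊆ {s, t}, ∀ W ∈ T.APlus G Z p,
    v.y p {s, t} D W =
      ∑ q ∈ T.pairsOf G p s t,
        ∑ S : Finset V with S ∈ T.APlusSet G Z q ∧ S ∩ {s, t} = D ∧ S ∩ T.bdPlus G p = W, v.x q S
  marginals : ∀ p s t, s ≠ t → (T.pairsOf G p s t).Nonempty → ∀ D ⊆ {s}, ∀ W ∈ T.APlus G Z p,
    v.z p s D W = ∑ D' ∈ ({s, t} : Finset V).powerset with D' ∩ {s} = D, v.y p {s, t} D' W
  separated : ∀ s t, s ≠ t →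
    v.ysep {s, t} =
      ∑ p : P, ∑ D' ∈ ({s, t} : Finset V).powerset with (D' ∩ {s, t}).card = 1,
        ∑ W : Finset V with W ∈ T.APlus G Z p, v.y p {s, t} D' W
  lift : ∀ p s t, s ≠ t → (T.pairsOf G p s t).Nonempty → ∀ W ∈ T.APlus G Z p,
    v.x {p} W =
      ∑ q ∈ T.pairsOf G p s t,
        ∑ S : Finset V with S ∈ T.APlusSet G Z q ∧ S ∩ T.bdPlus G p = W, v.x q S
  demand : α ≤ ∑ e : Finset V with e.card = 2, I.demand e * v.ysep e

/-- The objective of the linear program: the fractional cost of a solution. -/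
def _root_.PlanarSparsestCut.lpCost (I : CutInstance V) (v : LPVars P V) : ℝ :=
  ∑ e : Finset V with G.IsEdge e, I.cost e * v.ysep e

/-- The 0-1 values of the variables that encode a set `U` of dual faces and a forcing `φ`. -/
def encoding (φ : Q → P) (U : Finset V) : LPVars P V where
  x q S := if (∀ p ∈ q, T.Relevant φ p) ∧ U ∩ T.bdPlusSet G q = S then 1 else 0
  z p s D W :=
    if T.Relevant φ p ∧ (T.nodesOf G p s).Nonempty ∧ U ∩ {s} = D ∧ U ∩ T.bdPlus G p = W
    then 1 else 0
  y p e D W :=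
    if T.Relevant φ p ∧ (∃ s t, e = {s, t} ∧ s ≠ t ∧ (T.pairsOf G p s t).Nonempty) ∧
      U ∩ e = D ∧ U ∩ T.bdPlus G p = W
    then 1 else 0
  ysep e := if (U ∩ e).card = 1 then 1 else 0

end Decomposition

/-- The guesses for the separated demand: the powers of `1 + ε` between `1` and `n ^ 5`. -/
def guesses (n : ℕ) (ε : ℝ) : Set ℝ :=
  {α | (∃ i : ℕ, α = (1 + ε) ^ i) ∧ 1 ≤ α ∧ α ≤ (n : ℝ) ^ 5}

end

end PlanarSparsestCut

/-! The friendly pair `(φ, C)` supplied by the hypothesis already works. Let `U = C.inside` and let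
`d` be the demand it separates. Normalization puts `d` in `[1, n ^ 5]`, so some power `α` of `1 + ε`
satisfies `α ≤ d ≤ (1 + ε) * α`. The encoding has LP demand exactly `d` and LP cost exactly the cut
cost, which is at most `(1 + ε) Φ* d ≤ (1 + ε)² α Φ* ≤ (1 + 3ε) α Φ*`. The count of guesses follows
from `log (1 + ε) ≥ ε / 2`.

The real content is feasibility. Follow a dual face `s` down the forced tree: its vertices stay in a
single cluster until some relevant partition node separates them. This must happen, since leaves are
singletons and `s` has at least two vertices, and it happens only once
(`Relevant.exists_unique_node`). Hence a pair `s, t` determines one pair of relevant nodes, whose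
lowest common ancestor is a partition node (`Relevant.exists_isLCA`). That ancestor is the only
relevant `p` for which `𝒮(p, {s, t})` is nonempty (`Relevant.exists_pair`).

Restrictions of `U` are consistent because `∂⁺` grows along root paths (`bdPlus_mono`), and they
belong to `𝒜⁺` because all ancestors of a relevant node are relevant, so `C` is amenable for them.
Each linear constraint thus becomes an identity between an indicator and a sum of indicators with at
most one nonzero term. -/

namespace PlanarSparsestCut

open scoped Classical

/-! ### Sums of 0-1 indicators -/

section Indicators

/-- Collapses the sums over boundary sets: for a fixed node or pair, the encoding is supported on
the single set `a₀` that `U` cuts out. -/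
theorem sum_filter_indicator {α : Type*} [Fintype α] (p : α → Prop) (r : Prop) (a₀ : α)
    {_ : DecidablePred p} {_ : ∀ a, Decidable (r ∧ a₀ = a)} [Decidable (r ∧ p a₀)] :
    ∑ a : α with p a, (if r ∧ a₀ = a then (1 : ℝ) else 0) = if r ∧ p a₀ then 1 else 0 := by
  rw [Finset.sum_filter, Finset.sum_eq_single a₀]
  · by_cases hr : r <;> by_cases hp : p a₀ <;> simp [hr, hp]
  · intro b _ hb
    simp [Ne.symm hb]
  · simp

/-- The common shape of the equality constraints: the choice recorded by the remaining sum (a child,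
a node, a pair of nodes, a subset) is unique if it exists. -/
theorem sum_indicator_of_unique {α : Type*} (s : Finset α) (r : α → Prop) (c : Prop)
    {_ : DecidablePred r} {_ : Decidable c}
    (h : c → ∃ a ∈ s, r a ∧ ∀ b ∈ s, r b → b = a) (h' : ∀ a ∈ s, r a → c) :
    ∑ a ∈ s, (if r a then (1 : ℝ) else 0) = if c then 1 else 0 := by
  by_cases hc : c
  · obtain ⟨a, ha, hra, hu⟩ := h hc
    rw [Finset.sum_eq_single a]
    · simp [hra, hc]
    · intro b hb hne
      exact if_neg fun hrb => hne (hu b hb hrb)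
    · exact fun hn => absurd ha hn
  · rw [if_neg hc]
    exact Finset.sum_eq_zero fun a ha => if_neg fun hra => hc (h' a ha hra)

end Indicators

namespace Decomposition

variable {D V F P Q : Type u} [Fintype D] [Fintype V] [Fintype F] [Fintype P] [Fintype Q]
variable (T : Decomposition P Q F)

/-! ### Order structure of the decomposition tree -/

section Tree

theorem isParent_right_unique {a b x : P ⊕ Q} (ha : T.IsParent a x) (hb : T.IsParent b x) :
    a = b := by
  rcases a with a | a <;> rcases b with b | b <;> rcases x with x | x <;>
    simp_all [IsParent]

/-- Acyclicity is not a field of `Decomposition`. It comes from `reach_root`: accessibility passes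
from the root down each path, because every node has at most one parent. -/
theorem isParent_wellFounded : WellFounded T.IsParent := by
  have hP : ∀ p, Acc T.IsParent (Sum.inl p) := by
    intro p
    induction T.reach_root p with
    | refl =>
      refine ⟨_, fun y hy => ?_⟩
      rcases y with y | y
      · exact hy.elim
      · have h := (T.parentP_eq_none T.root).2 rfl
        simp [IsParent, h] at hy
    | tail _ h ih =>
      obtain ⟨c, hc, hb⟩ := h
      refine ⟨_, fun y hy => ?_⟩
      rcases y with y | y
      · exact hy.elim
      · have hyc : y = c := by
          simp only [IsParent, hb, Option.some.injEq] at hy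
          exact hy.symm
        subst hyc
        refine ⟨_, fun w hw => ?_⟩
        rcases w with w | w
        · have : w = T.parentQ y := Eq.symm hw
          rw [this, hc]
          exact ih
        · exact hw.elim
  refine ⟨fun x => ?_⟩
  rcases x with p | c
  · exact hP p
  · refine ⟨_, fun w hw => ?_⟩
    rcases w with w | w
    · exact hP w
    · exact hw.elim

theorem not_anc_of_isParent {a b : P ⊕ Q} (h : T.IsParent a b) : ¬ T.Anc b a := fun hba =>
  T.isParent_wellFounded.transGen.irrefl.irrefl a (Relation.TransGen.head' h hba)

/-- The tree is finite and has no cycles, so descending also terminates. -/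
theorem swap_isParent_wellFounded : WellFounded (Function.swap T.IsParent) := by
  have hirr : Std.Irrefl (Relation.TransGen (Function.swap T.IsParent)) :=
    ⟨fun a h => T.isParent_wellFounded.transGen.irrefl.irrefl a
      ((Relation.transGen_swap).1 h)⟩
  have hwf := Finite.wellFounded_of_trans_of_irrefl
    (Relation.TransGen (Function.swap T.IsParent))
  exact Subrelation.wf (fun h => Relation.TransGen.single h) hwf

theorem Anc.total {T : Decomposition P Q F} {a b x : P ⊕ Q} (ha : T.Anc a x) (hb : T.Anc b x) :
    T.Anc a b ∨ T.Anc b a := by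
  have hu : Relator.RightUnique (Function.swap T.IsParent) :=
    fun _ _ _ h h' => T.isParent_right_unique h h'
  rcases Relation.ReflTransGen.total_of_right_unique hu
    ((Relation.reflTransGen_swap).2 ha) ((Relation.reflTransGen_swap).2 hb) with h | h
  · exact Or.inr ((Relation.reflTransGen_swap).1 h)
  · exact Or.inl ((Relation.reflTransGen_swap).1 h)

theorem Anc.antisymm {T : Decomposition P Q F} {a b : P ⊕ Q} (hab : T.Anc a b)
    (hba : T.Anc b a) : a = b := by
  rcases Relation.ReflTransGen.cases_head hab with h | ⟨x, hx, hxb⟩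
  · exact h
  · exact absurd (hxb.trans hba) (T.not_anc_of_isParent hx)

theorem anc_inl_cases {p : P} {x : P ⊕ Q} (h : T.Anc (Sum.inl p) x) :
    Sum.inl p = x ∨ ∃ c, T.parentQ c = p ∧ T.Anc (Sum.inr c) x := by
  rcases Relation.ReflTransGen.cases_head h with h | ⟨y, hy, hyx⟩
  · exact Or.inl h
  · rcases y with y | y
    · exact hy.elim
    · exact Or.inr ⟨y, hy, hyx⟩

theorem anc_inr_inl_cases {c : Q} {q : P} (h : T.Anc (Sum.inr c) (Sum.inl q)) :
    ∃ p, T.parentP p = some c ∧ T.Anc (Sum.inl p) (Sum.inl q) := by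
  rcases Relation.ReflTransGen.cases_head h with h | ⟨y, hy, hyx⟩
  · simp at h
  · rcases y with y | y
    · exact ⟨y, hy, hyx⟩
    · exact hy.elim

theorem anc_of_parentQ {p : P} {c : Q} (h : T.parentQ c = p) :
    T.Anc (Sum.inl p) (Sum.inr c) :=
  Relation.ReflTransGen.single h

theorem anc_of_parentP {p : P} {c : Q} (h : T.parentP p = some c) :
    T.Anc (Sum.inr c) (Sum.inl p) :=
  Relation.ReflTransGen.single h

theorem anc_root (p : P) : T.Anc (Sum.inl T.root) (Sum.inl p) := by
  induction T.reach_root p with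
  | refl => exact Relation.ReflTransGen.refl
  | tail _ h ih =>
    obtain ⟨c, hc, hb⟩ := h
    exact (ih.trans (T.anc_of_parentQ hc)).trans (T.anc_of_parentP hb)

/-- Induction from the root towards the leaves. -/
theorem top_down_induction {motive : P → Prop} (root : motive T.root)
    (step : ∀ c p, T.parentP p = some c → motive (T.parentQ c) → motive p) (p : P) :
    motive p := by
  induction T.reach_root p with
  | refl => exact root
  | tail _ h ih =>
    obtain ⟨c, hc, hb⟩ := h
    exact step c _ hb (hc ▸ ih)

/-- Induction from the leaves towards the root. -/
theorem bottom_up_induction {motive : P → Prop}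
    (step : ∀ p, (∀ c p', T.parentQ c = p → T.parentP p' = some c → motive p') → motive p)
    (p : P) : motive p := by
  -- The motive is extended to cluster nodes, so that well-founded induction can run over the whole
  -- tree.
  have key : ∀ x : P ⊕ Q, Sum.elim motive
      (fun c => ∀ p', T.parentP p' = some c → motive p') x := by
    intro x
    induction x using T.swap_isParent_wellFounded.induction with
    | _ x ih =>
      rcases x with p | c
      · exact step p fun c p' hc hp' => ih (Sum.inr c) hc p' hp'
      · exact fun p' hp' => ih (Sum.inl p') hp'
  exact key (Sum.inl p)

theorem mem_partnPath {p p' : P} :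
    p' ∈ T.partnPath p ↔ T.Anc (Sum.inl p') (Sum.inl p) := by
  simp [partnPath]

theorem anc_child_cases {c : Q} {p p' : P} (hp : T.parentP p = some c)
    (h : T.Anc (Sum.inl p') (Sum.inl p)) :
    p' = p ∨ T.Anc (Sum.inl p') (Sum.inl (T.parentQ c)) := by
  rcases Relation.ReflTransGen.cases_tail h with h | ⟨y, hy, hyp⟩
  · exact Or.inl (Sum.inl.inj h).symm
  · have : y = Sum.inr c := T.isParent_right_unique hyp (by exact hp)
    subst this
    rcases Relation.ReflTransGen.cases_tail hy with h | ⟨w, hw, hwc⟩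
    · simp at h
    · have : w = Sum.inl (T.parentQ c) :=
        T.isParent_right_unique hwc (show T.IsParent (Sum.inl _) (Sum.inr c) from rfl)
      exact Or.inr (this ▸ hw)

theorem partnPath_child {c : Q} {p : P} (hp : T.parentP p = some c) :
    T.partnPath p = insert p (T.partnPath (T.parentQ c)) := by
  ext p'
  rw [Finset.mem_insert, mem_partnPath, mem_partnPath]
  refine ⟨T.anc_child_cases hp, ?_⟩
  rintro (rfl | h)
  · exact Relation.ReflTransGen.refl
  · exact (h.trans (T.anc_of_parentQ rfl)).trans (T.anc_of_parentP hp)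

theorem partnPath_root : T.partnPath T.root = {T.root} := by
  ext p
  rw [mem_partnPath, Finset.mem_singleton]
  refine ⟨fun h => Sum.inl.inj (h.antisymm (T.anc_root p)), ?_⟩
  rintro rfl
  exact Relation.ReflTransGen.refl

/-- A local test for lowest common ancestors. Ancestors of one node form a chain, so a common
ancestor not above `m` lies strictly below `m`, and then so does a child cluster of `m` above both
nodes. -/
theorem isLCA_inl_iff {a b m : P} :
    T.IsLCA (Sum.inl a) (Sum.inl b) (Sum.inl m) ↔
      T.Anc (Sum.inl m) (Sum.inl a) ∧ T.Anc (Sum.inl m) (Sum.inl b) ∧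
        ∀ c, T.parentQ c = m → T.Anc (Sum.inr c) (Sum.inl a) →
          ¬ T.Anc (Sum.inr c) (Sum.inl b) := by
  constructor
  · rintro ⟨ha, hb, h⟩
    exact ⟨ha, hb, fun c hc hca hcb =>
      T.not_anc_of_isParent (show T.IsParent (Sum.inl m) (Sum.inr c) from hc) (h _ hca hcb)⟩
  · rintro ⟨ha, hb, h⟩
    refine ⟨ha, hb, fun m' hma hmb => ?_⟩
    rcases hma.total ha with h' | h'
    · exact h'
    · rcases T.anc_inl_cases h' with rfl | ⟨c, hc, hcm⟩
      · exact Relation.ReflTransGen.refl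
      · exact absurd (hcm.trans hmb) (h c hc (hcm.trans hma))

theorem IsLCA.unique {T : Decomposition P Q F} {a b m m' : P ⊕ Q} (h : T.IsLCA a b m)
    (h' : T.IsLCA a b m') : m = m' :=
  (h'.2.2 m h.1 h.2.1).antisymm (h.2.2 m' h'.1 h'.2.1)

end Tree

/-! ### The partitions `π(p)` and `π⁺(p)` -/

section Partitions

theorem mem_parts {p : P} {A : Finset F} :
    A ∈ T.parts p ↔ ∃ c, T.parentQ c = p ∧ T.K c = A := by
  simp [parts]

theorem K_mem_parts (c : Q) : T.K c ∈ T.parts (T.parentQ c) := T.mem_parts.2 ⟨c, rfl, rfl⟩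

theorem ground_of_parentP {p : P} {c : Q} (h : T.parentP p = some c) : T.ground p = T.K c := by
  simp [ground, h]

theorem ground_root : T.ground T.root = Finset.univ := by
  simp [ground, (T.parentP_eq_none T.root).2 rfl]

theorem mem_ground_iff {p : P} {f : F} :
    f ∈ T.ground p ↔ ∃ c, T.parentQ c = p ∧ f ∈ T.K c := by
  rw [T.K_cover]
  cases h : T.parentP p with
  | none => simp [ground, h]
  | some c => simp [ground, h]

theorem K_subset_ground (c : Q) : T.K c ⊆ T.ground (T.parentQ c) :=
  fun _ hf => T.mem_ground_iff.2 ⟨c, rfl, hf⟩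

theorem mem_ground_iff_parts {p : P} {f : F} : f ∈ T.ground p ↔ ∃ A ∈ T.parts p, f ∈ A := by
  rw [mem_ground_iff]
  constructor
  · rintro ⟨c, rfl, hf⟩
    exact ⟨_, T.K_mem_parts c, hf⟩
  · rintro ⟨A, hA, hf⟩
    obtain ⟨c, hc, rfl⟩ := T.mem_parts.1 hA
    exact ⟨c, hc, hf⟩

theorem parts_eq_of_mem {p : P} {A B : Finset F} (hA : A ∈ T.parts p) (hB : B ∈ T.parts p)
    {f : F} (hfA : f ∈ A) (hfB : f ∈ B) : A = B := by
  obtain ⟨c, hc, rfl⟩ := T.mem_parts.1 hA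
  obtain ⟨c', hc', rfl⟩ := T.mem_parts.1 hB
  by_contra hne
  exact Finset.disjoint_left.1
    (T.K_disjoint c c' (hc.trans hc'.symm) fun h => hne (h ▸ rfl)) hfA hfB

theorem cluster_eq_of_mem {c c' : Q} (h : T.parentQ c = T.parentQ c') {f : F}
    (hf : f ∈ T.K c) (hf' : f ∈ T.K c') : c = c' := by
  by_contra hne
  exact Finset.disjoint_left.1 (T.K_disjoint c c' h hne) hf hf'

theorem Anc.ground_subset {T : Decomposition P Q F} {a b : P ⊕ Q} (h : T.Anc a b) :
    Sum.elim T.ground T.K b ⊆ Sum.elim T.ground T.K a := by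
  induction h with
  | refl => exact subset_rfl
  | @tail x y _ hxy ih =>
    refine subset_trans ?_ ih
    rcases x with p | c <;> rcases y with p' | c'
    · exact hxy.elim
    · have : T.parentQ c' = p := hxy
      subst this
      exact T.K_subset_ground c'
    · exact (T.ground_of_parentP hxy).subset
    · exact hxy.elim

theorem partsPlus_root : T.partsPlus T.root = T.parts T.root := by
  rw [partsPlus, partnPath_root, Finset.singleton_biUnion, Finset.union_eq_left]
  exact Finset.filter_subset _ _

theorem parts_subset_partsPlus (p : P) : T.parts p ⊆ T.partsPlus p :=
  Finset.subset_union_left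

/-- The recursion for `π⁺`: one step down replaces the part `K c` by the parts of `π(p)`.
Disjointness at the parent ensures that `K c` is the only part containing `K c`. It is a hypothesis
here because its own proof by induction uses this recursion. -/
theorem partsPlus_child_of_eq_of_mem {c : Q} {p : P} (hp : T.parentP p = some c)
    (hdisj : ∀ A ∈ T.partsPlus (T.parentQ c), ∀ B ∈ T.partsPlus (T.parentQ c),
      ∀ f ∈ A, f ∈ B → A = B) :
    T.partsPlus p = T.parts p ∪ (T.partsPlus (T.parentQ c)).erase (T.K c) := by
  have hKc : T.K c ∈ T.partsPlus (T.parentQ c) :=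
    T.parts_subset_partsPlus _ (T.K_mem_parts c)
  ext A
  have hg := T.ground_of_parentP hp
  rw [partsPlus, Finset.mem_union, Finset.mem_union, T.partnPath_child hp,
    Finset.biUnion_insert, Finset.mem_filter, Finset.mem_union, Finset.mem_erase, hg]
  constructor
  · rintro (h | ⟨h | h, hKA⟩)
    · exact Or.inl h
    · exact Or.inl h
    · refine Or.inr ⟨fun e => hKA e.symm.subset, ?_⟩
      rw [partsPlus, Finset.mem_union, Finset.mem_filter]
      exact Or.inr ⟨h, fun hA => hKA ((T.K_subset_ground c).trans hA)⟩
  · rintro (h | ⟨hne, h⟩)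
    · exact Or.inl h
    · refine Or.inr ⟨Or.inr ?_, fun hKA => ?_⟩
      · rw [partsPlus, Finset.mem_union, Finset.mem_filter] at h
        rcases h with h | h
        · exact Finset.mem_biUnion.2
            ⟨_, T.mem_partnPath.2 Relation.ReflTransGen.refl, h⟩
        · exact h.1
      · obtain ⟨f, hf⟩ := T.K_nonempty c
        exact hne (hdisj A h _ hKc f (hKA hf) hf)

theorem partsPlus_eq_of_mem (p : P) : ∀ A ∈ T.partsPlus p, ∀ B ∈ T.partsPlus p,
    ∀ f ∈ A, f ∈ B → A = B := by
  induction p using T.top_down_induction with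
  | root =>
    rw [partsPlus_root]
    exact fun A hA B hB f hfA hfB => T.parts_eq_of_mem hA hB hfA hfB
  | step c p hp ih =>
    have hKc : T.K c ∈ T.partsPlus (T.parentQ c) :=
      T.parts_subset_partsPlus _ (T.K_mem_parts c)
    have hmix : ∀ A ∈ T.parts p, ∀ B ∈ (T.partsPlus (T.parentQ c)).erase (T.K c),
        ∀ f ∈ A, f ∉ B := by
      intro A hA B hB f hfA hfB
      have hf : f ∈ T.K c := T.ground_of_parentP hp ▸ T.mem_ground_iff_parts.2 ⟨A, hA, hfA⟩
      exact (Finset.mem_erase.1 hB).1 (ih B (Finset.mem_erase.1 hB).2 _ hKc f hfB hf)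
    rw [T.partsPlus_child_of_eq_of_mem hp ih]
    intro A hA B hB f hfA hfB
    rcases Finset.mem_union.1 hA with hA | hA <;> rcases Finset.mem_union.1 hB with hB | hB
    · exact T.parts_eq_of_mem hA hB hfA hfB
    · exact absurd hfB (hmix A hA B hB f hfA)
    · exact absurd hfA (hmix B hB A hA f hfB)
    · exact ih A (Finset.mem_erase.1 hA).2 B (Finset.mem_erase.1 hB).2 f hfA hfB

theorem partsPlus_child {c : Q} {p : P} (hp : T.parentP p = some c) :
    T.partsPlus p = T.parts p ∪ (T.partsPlus (T.parentQ c)).erase (T.K c) :=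
  T.partsPlus_child_of_eq_of_mem hp (T.partsPlus_eq_of_mem _)

theorem exists_mem_partsPlus (p : P) (f : F) : ∃ A ∈ T.partsPlus p, f ∈ A := by
  induction p using T.top_down_induction with
  | root =>
    rw [partsPlus_root]
    exact T.mem_ground_iff_parts.1 (T.ground_root ▸ Finset.mem_univ f)
  | step c p hp ih =>
    rw [T.partsPlus_child hp]
    obtain ⟨A, hA, hf⟩ := ih
    by_cases h : A = T.K c
    · obtain ⟨B, hB, hfB⟩ := T.mem_ground_iff_parts.1 ((T.ground_of_parentP hp).symm ▸ h ▸ hf)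
      exact ⟨B, Finset.mem_union_left _ hB, hfB⟩
    · exact ⟨A, Finset.mem_union_right _ (Finset.mem_erase.2 ⟨h, hA⟩), hf⟩

theorem partsPlus_child_refines {c : Q} {p : P} (hp : T.parentP p = some c) {A : Finset F}
    (hA : A ∈ T.partsPlus p) : ∃ B ∈ T.partsPlus (T.parentQ c), A ⊆ B := by
  rw [T.partsPlus_child hp] at hA
  rcases Finset.mem_union.1 hA with hA | hA
  · refine ⟨T.K c, T.parts_subset_partsPlus _ (T.K_mem_parts c), fun f hf => ?_⟩
    exact T.ground_of_parentP hp ▸ T.mem_ground_iff_parts.2 ⟨A, hA, hf⟩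
  · exact ⟨A, (Finset.mem_erase.1 hA).2, subset_rfl⟩

end Partitions

/-! ### Boundaries of partitions and the index sets of the program -/

section Boundaries

variable (G : PlaneGraph D V F)

theorem mem_boundary {π : Finset (Finset F)} {s : V} :
    s ∈ boundary G π ↔ (∀ f ∈ G.faceVerts s, ∃ A ∈ π, f ∈ A) ∧
      ∃ A ∈ π, ∃ B ∈ π, A ≠ B ∧ (∃ f ∈ G.faceVerts s, f ∈ A) ∧
        ∃ f ∈ G.faceVerts s, f ∈ B := by
  simp [boundary]

theorem faceVerts_subset_ground {p : P} {s : V} (h : s ∈ T.bd G p) :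
    G.faceVerts s ⊆ T.ground p :=
  fun f hf => T.mem_ground_iff_parts.2 (((mem_boundary G).1 h).1 f hf)

theorem not_faceVerts_subset_of_mem_bd {p : P} {s : V} (h : s ∈ T.bd G p) {c : Q}
    (hc : T.parentQ c = p) : ¬ G.faceVerts s ⊆ T.K c := by
  intro hs
  obtain ⟨-, A, hA, B, hB, hne, ⟨f, hf, hfA⟩, g, hg, hgB⟩ := (mem_boundary G).1 h
  have hKc : T.K c ∈ T.parts p := hc ▸ T.K_mem_parts c
  exact hne ((T.parts_eq_of_mem hA hKc hfA (hs hf)).trans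
    (T.parts_eq_of_mem hKc hB (hs hg) hgB))

theorem bd_subset_bdPlus (p : P) : T.bd G p ⊆ T.bdPlus G p := by
  intro s hs
  obtain ⟨-, A, hA, B, hB, h⟩ := (mem_boundary G).1 hs
  exact (mem_boundary G).2 ⟨fun f _ => T.exists_mem_partsPlus p f, A,
    T.parts_subset_partsPlus p hA, B, T.parts_subset_partsPlus p hB, h⟩

/-- `π⁺` only gets finer going down, so two vertices of a face that are separated at the parent
remain separated at the child. -/
theorem bdPlus_subset_child {c : Q} {p : P} (hp : T.parentP p = some c) :
    T.bdPlus G (T.parentQ c) ⊆ T.bdPlus G p := by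
  intro s hs
  obtain ⟨-, A, hA, B, hB, hne, ⟨f, hf, hfA⟩, g, hg, hgB⟩ := (mem_boundary G).1 hs
  obtain ⟨A', hA', hfA'⟩ := T.exists_mem_partsPlus p f
  obtain ⟨B', hB', hgB'⟩ := T.exists_mem_partsPlus p g
  refine (mem_boundary G).2 ⟨fun f _ => T.exists_mem_partsPlus p f, A', hA', B', hB', ?_,
    ⟨f, hf, hfA'⟩, g, hg, hgB'⟩
  rintro rfl
  obtain ⟨E, hE, hAE⟩ := T.partsPlus_child_refines hp hA'
  exact hne ((T.partsPlus_eq_of_mem _ A hA E hE f hfA (hAE hfA')).trans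
    (T.partsPlus_eq_of_mem _ E hE B hB g (hAE hgB') hgB))

theorem bdPlus_mono {p q : P} (h : T.Anc (Sum.inl p) (Sum.inl q)) :
    T.bdPlus G p ⊆ T.bdPlus G q := by
  induction q using T.top_down_induction with
  | root =>
    have : p = T.root := Sum.inl.inj (h.antisymm (T.anc_root p))
    rw [this]
  | step c q hq ih =>
    rcases T.anc_child_cases hq h with rfl | h
    · exact subset_rfl
    · exact (ih h).trans (T.bdPlus_subset_child G hq)

theorem bdPlus_root : T.bdPlus G T.root = ∅ := by
  rw [Finset.eq_empty_iff_forall_notMem]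
  intro s hs
  obtain ⟨-, A, hA, B, hB, hne, -⟩ := (mem_boundary G).1 hs
  rw [partsPlus_root] at hA hB
  obtain ⟨c, hc, rfl⟩ := T.mem_parts.1 hA
  obtain ⟨c', hc', rfl⟩ := T.mem_parts.1 hB
  exact hne ((T.K_root c hc).trans (T.K_root c' hc').symm)

theorem bdPlusSet_singleton (p : P) : T.bdPlusSet G {p} = T.bdPlus G p := by
  simp [bdPlusSet]

theorem bdPlus_subset_bdPlusSet {q : Finset P} {p : P} (hp : p ∈ q) :
    T.bdPlus G p ⊆ T.bdPlusSet G q :=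
  Finset.subset_biUnion_of_mem (T.bdPlus G) hp

theorem mem_nodesOf {p ps : P} {s : V} :
    ps ∈ T.nodesOf G p s ↔ T.Anc (Sum.inl p) (Sum.inl ps) ∧ s ∈ T.bd G ps := by
  simp [nodesOf]

theorem mem_pairsOf {p : P} {s t : V} {q : Finset P} :
    q ∈ T.pairsOf G p s t ↔ ∃ ps pt, q = {ps, pt} ∧ s ∈ T.bd G ps ∧ t ∈ T.bd G pt ∧
      T.IsLCA (Sum.inl ps) (Sum.inl pt) (Sum.inl p) := by
  simp [pairsOf]

theorem pairsOf_comm (p : P) (s t : V) : T.pairsOf G p s t = T.pairsOf G p t s := by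
  have key : ∀ s t, T.pairsOf G p s t ⊆ T.pairsOf G p t s := by
    intro s t q hq
    obtain ⟨ps, pt, rfl, hs, ht, h⟩ := (T.mem_pairsOf G).1 hq
    exact (T.mem_pairsOf G).2 ⟨pt, ps, Finset.pair_comm _ _, ht, hs,
      h.2.1, h.1, fun m hm hm' => h.2.2 m hm' hm⟩
  exact (key s t).antisymm (key t s)

/-- The encoding of `y` sees only the unordered pair; by symmetry of `pairsOf` the chosen ordering
is immaterial. -/
theorem exists_pairsOf_nonempty_iff (p : P) {s t : V} (hst : s ≠ t) :
    (∃ s' t', ({s, t} : Finset V) = {s', t'} ∧ s' ≠ t' ∧ (T.pairsOf G p s' t').Nonempty) ↔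
      (T.pairsOf G p s t).Nonempty := by
  constructor
  · rintro ⟨s', t', h, -, hne⟩
    have h' : (s = s' ∧ t = t') ∨ (s = t' ∧ t = s') := by
      have := congrArg (fun e : Finset V => (e : Set V)) h
      simp only [Finset.coe_pair] at this
      exact Set.pair_eq_pair_iff.1 this
    rcases h' with ⟨rfl, rfl⟩ | ⟨rfl, rfl⟩
    · exact hne
    · rwa [T.pairsOf_comm]
  · exact fun h => ⟨s, t, rfl, hst, h⟩

end Boundaries

/-! ### Relevant nodes of the forced tree -/

section Relevant

variable {T} {φ : Q → P}

theorem Relevant.of_anc {p q : P} (hq : T.Relevant φ q) (h : T.Anc (Sum.inl p) (Sum.inl q)) :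
    T.Relevant φ p :=
  fun p' hp' => hq p' (T.mem_partnPath.2 ((T.mem_partnPath.1 hp').trans h))

theorem Relevant.eq_of_parentP {p : P} (hp : T.Relevant φ p) {c : Q}
    (hc : T.parentP p = some c) : φ c = p :=
  hp p (T.mem_partnPath.2 Relation.ReflTransGen.refl) c hc

theorem Relevant.child {c : Q} (h : T.Relevant φ (T.parentQ c))
    (hc : T.parentP (φ c) = some c) : T.Relevant φ (φ c) := by
  intro p' hp' c' hc'
  rw [T.partnPath_child hc, Finset.mem_insert] at hp'
  rcases hp' with rfl | hp'
  · rw [hc, Option.some.injEq] at hc'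
    rw [hc']
  · exact h p' hp' c' hc'

theorem relevant_root : T.Relevant φ T.root := by
  intro p hp c hc
  rw [T.partnPath_root, Finset.mem_singleton] at hp
  rw [hp, (T.parentP_eq_none T.root).2 rfl] at hc
  simp at hc

variable {G : PlaneGraph D V F}

/-- A face that lies in the ground set of a relevant node `p` is on the boundary of exactly one
relevant descendant of `p`. -/
theorem Relevant.exists_unique_node (hG : ∀ s : V, 2 ≤ (G.faceVerts s).card)
    (hφ : T.IsForcing φ) {s : V} (p : P) (hp : T.Relevant φ p)
    (hs : G.faceVerts s ⊆ T.ground p) :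
    ∃ ps, (T.Anc (Sum.inl p) (Sum.inl ps) ∧ T.Relevant φ ps ∧ s ∈ T.bd G ps) ∧
      ∀ ps', T.Anc (Sum.inl p) (Sum.inl ps') → T.Relevant φ ps' → s ∈ T.bd G ps' →
        ps' = ps := by
  induction p using T.bottom_up_induction with
  | step p ih =>
    by_cases hbd : s ∈ T.bd G p
    · refine ⟨p, ⟨Relation.ReflTransGen.refl, hp, hbd⟩, fun ps' h _ hs' => ?_⟩
      rcases T.anc_inl_cases h with h | ⟨c, hc, h⟩
      · exact (Sum.inl.inj h).symm
      · exact absurd ((T.faceVerts_subset_ground G hs').trans h.ground_subset)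
          (T.not_faceVerts_subset_of_mem_bd G hbd hc)
    · obtain ⟨f, hf⟩ : (G.faceVerts s).Nonempty :=
        Finset.card_pos.1 (lt_of_lt_of_le two_pos (hG s))
      obtain ⟨c, rfl, hfc⟩ := T.mem_ground_iff.1 (hs hf)
      -- Not being separated at `p`, the face lies wholly in the part of any one of its vertices.
      have hsc : G.faceVerts s ⊆ T.K c := by
        intro g hg
        by_contra hgc
        obtain ⟨A, hA, hgA⟩ := T.mem_ground_iff_parts.1 (hs hg)
        exact hbd ((mem_boundary G).2 ⟨fun g hg => T.mem_ground_iff_parts.1 (hs hg),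
          T.K c, T.K_mem_parts c, A, hA, fun h => hgc (h ▸ hgA), ⟨f, hf, hfc⟩, g, hg, hgA⟩)
      -- A leaf cluster has one vertex, whereas `s` has at least two; so the descent can continue to
      -- `φ c`.
      have hleaf : ∃ p', T.parentP p' = some c := by
        by_contra hno
        have h1 := T.leaf_singleton c (not_exists.1 hno)
        have h2 := (hG s).trans (Finset.card_le_card hsc)
        omega
      have hφc := hφ c hleaf
      obtain ⟨ps, ⟨hanc, hrel, hps⟩, hu⟩ := ih c (φ c) rfl hφc (hp.child hφc)
        (T.ground_of_parentP hφc ▸ hsc)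
      refine ⟨ps, ⟨((T.anc_of_parentQ rfl).trans (T.anc_of_parentP hφc)).trans hanc,
        hrel, hps⟩, fun ps' h hr hs' => ?_⟩
      rcases T.anc_inl_cases h with h | ⟨c', hc', hcs⟩
      · rw [← Sum.inl.inj h] at hs'
        exact absurd hs' hbd
      -- Any competing node lies below a cluster containing `f`, hence below `c`, and relevance
      -- sends its path through `φ c`.
      · have hfc' : f ∈ T.K c' := hcs.ground_subset (T.faceVerts_subset_ground G hs' hf)
        obtain rfl := T.cluster_eq_of_mem hc' hfc' hfc
        obtain ⟨p', hp', h'⟩ := T.anc_inr_inl_cases hcs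
        have := (hr.of_anc h').eq_of_parentP hp'
        exact hu ps' (this ▸ h') hr hs'

theorem Relevant.node_eq (hG : ∀ s : V, 2 ≤ (G.faceVerts s).card) (hφ : T.IsForcing φ) {s : V}
    {p p' : P} (hp : T.Relevant φ p) (hp' : T.Relevant φ p') (hs : s ∈ T.bd G p)
    (hs' : s ∈ T.bd G p') : p = p' := by
  obtain ⟨ps, -, hu⟩ := relevant_root.exists_unique_node (s := s) hG hφ T.root
    (T.ground_root ▸ Finset.subset_univ _)
  exact (hu p (T.anc_root p) hp hs).trans (hu p' (T.anc_root p') hp' hs').symm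

/-- If some pair in `𝒮(p, {s, t})` exists and `p` is relevant, then the relevant nodes of `s` and
`t` form such a pair. -/
theorem Relevant.exists_pair (hG : ∀ s : V, 2 ≤ (G.faceVerts s).card) (hφ : T.IsForcing φ)
    {s t : V} {p : P} (hp : T.Relevant φ p) (h : (T.pairsOf G p s t).Nonempty) :
    ∃ ps pt, T.Relevant φ ps ∧ T.Relevant φ pt ∧ s ∈ T.bd G ps ∧ t ∈ T.bd G pt ∧
      T.IsLCA (Sum.inl ps) (Sum.inl pt) (Sum.inl p) := by
  obtain ⟨q, hq⟩ := h
  obtain ⟨ps', pt', -, hs', ht', hlca⟩ := (T.mem_pairsOf G).1 hq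
  rw [isLCA_inl_iff] at hlca
  obtain ⟨hps', hpt', hno⟩ := hlca
  obtain ⟨ps, ⟨hps, hrs, hs⟩, -⟩ := hp.exists_unique_node hG hφ p
    ((T.faceVerts_subset_ground G hs').trans hps'.ground_subset)
  obtain ⟨pt, ⟨hpt, hrt, ht⟩, -⟩ := hp.exists_unique_node hG hφ p
    ((T.faceVerts_subset_ground G ht').trans hpt'.ground_subset)
  refine ⟨ps, pt, hrs, hrt, hs, ht, T.isLCA_inl_iff.2 ⟨hps, hpt, fun c hc hcs hct => ?_⟩⟩
  -- The given pair may be irrelevant and must be compared with the relevant one. Which child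
  -- cluster of `p` a boundary node of `w` lies under is decided by the vertices of `w` alone,
  -- independently of the forcing. So a cluster above both relevant nodes would also be above both
  -- given nodes.
  have below : ∀ r r' : P, ∀ w : V, w ∈ T.bd G r → w ∈ T.bd G r' →
      T.Anc (Sum.inl p) (Sum.inl r') → T.Anc (Sum.inr c) (Sum.inl r) →
      T.Anc (Sum.inr c) (Sum.inl r') := by
    intro r r' w hw hw' hr' hr
    have hwc : G.faceVerts w ⊆ T.K c :=
      (T.faceVerts_subset_ground G hw).trans hr.ground_subset
    rcases T.anc_inl_cases hr' with e | ⟨c', hc', h'⟩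
    · rw [← Sum.inl.inj e] at hw'
      exact absurd hwc (T.not_faceVerts_subset_of_mem_bd G hw' hc)
    · obtain ⟨f, hf⟩ : (G.faceVerts w).Nonempty :=
        Finset.card_pos.1 (lt_of_lt_of_le two_pos (hG w))
      have hfc' : f ∈ T.K c' := h'.ground_subset (T.faceVerts_subset_ground G hw' hf)
      rwa [T.cluster_eq_of_mem (hc.trans hc'.symm) (hwc hf) hfc']
  exact hno c hc (below ps ps' s hs hs' hps' hcs) (below pt pt' t ht ht' hpt' hct)

/-- Two relevant nodes have a partition node as their lowest common ancestor. -/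
theorem Relevant.exists_isLCA {a b : P} (ha : T.Relevant φ a) (hb : T.Relevant φ b) :
    ∃ m, T.IsLCA (Sum.inl a) (Sum.inl b) (Sum.inl m) := by
  have key : ∀ m, T.Anc (Sum.inl m) (Sum.inl a) → T.Anc (Sum.inl m) (Sum.inl b) →
      ∃ m, T.IsLCA (Sum.inl a) (Sum.inl b) (Sum.inl m) := by
    intro m
    induction m using T.bottom_up_induction with
    | step m ih =>
      intro hma hmb
      -- If a child cluster `c` is above both nodes, both paths leave it through the same chosen
      -- child `φ c`, so the descent continues from there. A cluster node is therefore never the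
      -- lowest common ancestor.
      by_cases h : ∃ c, T.parentQ c = m ∧ T.Anc (Sum.inr c) (Sum.inl a) ∧
          T.Anc (Sum.inr c) (Sum.inl b)
      · obtain ⟨c, hc, hca, hcb⟩ := h
        obtain ⟨p, hp, hpa⟩ := T.anc_inr_inl_cases hca
        obtain ⟨p', hp', hpb⟩ := T.anc_inr_inl_cases hcb
        have e : p = p' := ((ha.of_anc hpa).eq_of_parentP hp).symm.trans
          ((hb.of_anc hpb).eq_of_parentP hp')
        exact ih c p hc hp hpa (e ▸ hpb)
      · exact ⟨m, T.isLCA_inl_iff.2 ⟨hma, hmb, fun c hc hca hcb => h ⟨c, hc, hca, hcb⟩⟩⟩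
  exact key T.root (T.anc_root a) (T.anc_root b)

end Relevant

/-! ### The encoding satisfies each constraint -/

section Encoding

variable {T} {φ : Q → P} {G : PlaneGraph D V F} {Z : ℕ} {C : G.DualCycle}

theorem inside_inter_mem_APlus (hC : T.AmenableForced Z φ C) {p : P} (hp : T.Relevant φ p) :
    C.inside ∩ T.bdPlus G p ∈ T.APlus G Z p :=
  ⟨C, fun p' hp' => hC p' (hp.of_anc (T.mem_partnPath.1 hp')), rfl⟩

theorem inside_inter_mem_APlusSet (hC : T.AmenableForced Z φ C) {q : Finset P}
    (hq : ∀ p ∈ q, T.Relevant φ p) : C.inside ∩ T.bdPlusSet G q ∈ T.APlusSet G Z q :=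
  ⟨fun p => C.inside ∩ T.bdPlus G p, fun p hp => inside_inter_mem_APlus hC (hq p hp), by
    rw [bdPlusSet, Finset.inter_biUnion]⟩

theorem inter_inter_of_subset {α : Type*} {U B A : Finset α} (h : A ⊆ B) :
    U ∩ B ∩ A = U ∩ A := by
  rw [Finset.inter_assoc, Finset.inter_eq_right.2 h]

theorem sum_encoding_x (U : Finset V) (q : Finset P) (r : Finset V → Prop)
    {_ : DecidablePred r} :
    ∑ S : Finset V with r S, (T.encoding G φ U).x q S =
      if (∀ p ∈ q, T.Relevant φ p) ∧ r (U ∩ T.bdPlusSet G q) then 1 else 0 := by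
  simp only [encoding]
  rw [sum_filter_indicator]

theorem encoding_x_singleton (U : Finset V) (p : P) (S : Finset V) :
    (T.encoding G φ U).x {p} S =
      if T.Relevant φ p ∧ U ∩ T.bdPlus G p = S then 1 else 0 := by
  simp [encoding, bdPlusSet_singleton]

theorem encoding_y_pair (U : Finset V) (p : P) {s t : V} (hst : s ≠ t) (D' W : Finset V) :
    (T.encoding G φ U).y p {s, t} D' W =
      if T.Relevant φ p ∧ (T.pairsOf G p s t).Nonempty ∧ U ∩ {s, t} = D' ∧
        U ∩ T.bdPlus G p = W then 1 else 0 := by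
  simp only [encoding, T.exists_pairsOf_nonempty_iff G p hst]

theorem relevant_of_mem_pairsOf {p : P} {s t : V} {q : Finset P} (hq : q ∈ T.pairsOf G p s t)
    (hr : ∀ r ∈ q, T.Relevant φ r) : T.Relevant φ p := by
  obtain ⟨ps, pt, rfl, -, -, h⟩ := (T.mem_pairsOf G).1 hq
  exact (hr ps (by simp)).of_anc h.1

theorem bdPlus_subset_of_mem_pairsOf {p : P} {s t : V} {q : Finset P}
    (hq : q ∈ T.pairsOf G p s t) : T.bdPlus G p ⊆ T.bdPlusSet G q := by
  obtain ⟨ps, pt, rfl, -, -, h⟩ := (T.mem_pairsOf G).1 hq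
  exact (T.bdPlus_mono G h.1).trans (T.bdPlus_subset_bdPlusSet G (by simp))

theorem pair_subset_of_mem_pairsOf {p : P} {s t : V} {q : Finset P}
    (hq : q ∈ T.pairsOf G p s t) : {s, t} ⊆ T.bdPlusSet G q := by
  obtain ⟨ps, pt, rfl, hs, ht, -⟩ := (T.mem_pairsOf G).1 hq
  intro w hw
  rcases Finset.mem_insert.1 hw with rfl | hw
  · exact T.bdPlus_subset_bdPlusSet G (p := ps) (by simp) (T.bd_subset_bdPlus G _ hs)
  · rw [Finset.mem_singleton.1 hw]
    exact T.bdPlus_subset_bdPlusSet G (p := pt) (by simp) (T.bd_subset_bdPlus G _ ht)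

/-- Summing the indicators of the fully relevant pairs in `𝒮(p, {s, t})`. -/
theorem sum_pairsOf_indicator (hG : ∀ s : V, 2 ≤ (G.faceVerts s).card) (hφ : T.IsForcing φ)
    (p : P) (s t : V) (c : Prop) [∀ q : Finset P, Decidable ((∀ r ∈ q, T.Relevant φ r) ∧ c)]
    {_ : Decidable (T.Relevant φ p ∧ (T.pairsOf G p s t).Nonempty ∧ c)} :
    ∑ q ∈ T.pairsOf G p s t, (if (∀ r ∈ q, T.Relevant φ r) ∧ c then (1 : ℝ) else 0) =
      if T.Relevant φ p ∧ (T.pairsOf G p s t).Nonempty ∧ c then 1 else 0 := by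
  apply sum_indicator_of_unique
  · rintro ⟨hp, hne, hc⟩
    obtain ⟨ps, pt, hrs, hrt, hs, ht, hlca⟩ := hp.exists_pair hG hφ hne
    refine ⟨{ps, pt}, (T.mem_pairsOf G).2 ⟨ps, pt, rfl, hs, ht, hlca⟩,
      ⟨by simp [hrs, hrt], hc⟩, ?_⟩
    rintro q hq ⟨hr, -⟩
    obtain ⟨ps', pt', rfl, hs', ht', -⟩ := (T.mem_pairsOf G).1 hq
    -- Each face has only one relevant boundary node, which fixes both members of the pair; they may
    -- coincide.
    rw [(hr ps' (by simp)).node_eq hG hφ hrs hs' hs, (hr pt' (by simp)).node_eq hG hφ hrt ht' ht]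
  · rintro q hq ⟨hr, hc⟩
    exact ⟨relevant_of_mem_pairsOf hq hr, ⟨q, hq⟩, hc⟩

theorem encoding_assign (hφ : T.IsForcing φ) (hC : T.AmenableForced Z φ C) {c : Q}
    (hc : ∃ p, T.parentP p = some c) (S : Finset V) :
    (T.encoding G φ C.inside).x {T.parentQ c} S =
      ∑ p : P with T.parentP p = some c,
        ∑ S' : Finset V with S' ∈ T.APlus G Z p ∧ S' ∩ T.bdPlus G (T.parentQ c) = S,
          (T.encoding G φ C.inside).x {p} S' := by
  rw [encoding_x_singleton]
  simp only [sum_encoding_x, bdPlusSet_singleton, Finset.mem_singleton, forall_eq]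
  symm
  have hsub : ∀ p, T.parentP p = some c → C.inside ∩ T.bdPlus G p ∩ T.bdPlus G (T.parentQ c) =
      C.inside ∩ T.bdPlus G (T.parentQ c) :=
    fun p hp => inter_inter_of_subset (T.bdPlus_subset_child G hp)
  apply sum_indicator_of_unique
  · rintro ⟨hp, rfl⟩
    have hφc := hφ c hc
    refine ⟨φ c, by simpa using hφc,
      ⟨hp.child hφc, inside_inter_mem_APlus hC (hp.child hφc), hsub _ hφc⟩, ?_⟩
    rintro p hpc ⟨hr, -⟩
    exact (hr.eq_of_parentP (by simpa using hpc)).symm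
  · rintro p hpc ⟨hr, -, hS⟩
    have hpc : T.parentP p = some c := by simpa using hpc
    exact ⟨hr.of_anc ((T.anc_of_parentQ rfl).trans (T.anc_of_parentP hpc)),
      (hsub p hpc).symm.trans hS⟩

theorem encoding_proj_z (hG : ∀ s : V, 2 ≤ (G.faceVerts s).card) (hφ : T.IsForcing φ)
    (hC : T.AmenableForced Z φ C) (p : P) (s : V) (D' W : Finset V) :
    (T.encoding G φ C.inside).z p s D' W =
      ∑ ps ∈ T.nodesOf G p s,
        ∑ S : Finset V with S ∈ T.APlus G Z ps ∧ S ∩ {s} = D' ∧ S ∩ T.bdPlus G p = W,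
          (T.encoding G φ C.inside).x {ps} S := by
  simp only [sum_encoding_x, bdPlusSet_singleton, Finset.mem_singleton, forall_eq]
  symm
  have hs : ∀ ps ∈ T.nodesOf G p s,
      C.inside ∩ T.bdPlus G ps ∩ {s} = C.inside ∩ {s} := fun ps h =>
    inter_inter_of_subset (Finset.singleton_subset_iff.2
      (T.bd_subset_bdPlus G _ ((T.mem_nodesOf G).1 h).2))
  have hp : ∀ ps ∈ T.nodesOf G p s,
      C.inside ∩ T.bdPlus G ps ∩ T.bdPlus G p = C.inside ∩ T.bdPlus G p := fun ps h =>
    inter_inter_of_subset (T.bdPlus_mono G ((T.mem_nodesOf G).1 h).1)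
  apply sum_indicator_of_unique
  · rintro ⟨hr, ⟨ps', hps'⟩, rfl, rfl⟩
    obtain ⟨hanc', hs'⟩ := (T.mem_nodesOf G).1 hps'
    obtain ⟨ps, ⟨hanc, hrs, hbd⟩, hu⟩ := hr.exists_unique_node hG hφ p
      ((T.faceVerts_subset_ground G hs').trans hanc'.ground_subset)
    have hmem := (T.mem_nodesOf G).2 ⟨hanc, hbd⟩
    refine ⟨ps, hmem, ⟨hrs, inside_inter_mem_APlus hC hrs, hs ps hmem, hp ps hmem⟩, ?_⟩
    rintro q hq ⟨hrq, -⟩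
    obtain ⟨hq1, hq2⟩ := (T.mem_nodesOf G).1 hq
    exact hu q hq1 hrq hq2
  · rintro ps hps ⟨hr, -, h1, h2⟩
    exact ⟨hr.of_anc ((T.mem_nodesOf G).1 hps).1, ⟨ps, hps⟩, (hs ps hps).symm.trans h1,
      (hp ps hps).symm.trans h2⟩

theorem encoding_proj_y (hG : ∀ s : V, 2 ≤ (G.faceVerts s).card) (hφ : T.IsForcing φ)
    (hC : T.AmenableForced Z φ C) (p : P) {s t : V} (hst : s ≠ t) (D' W : Finset V) :
    (T.encoding G φ C.inside).y p {s, t} D' W =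
      ∑ q ∈ T.pairsOf G p s t,
        ∑ S : Finset V with S ∈ T.APlusSet G Z q ∧ S ∩ {s, t} = D' ∧ S ∩ T.bdPlus G p = W,
          (T.encoding G φ C.inside).x q S := by
  rw [encoding_y_pair _ _ hst, ← sum_pairsOf_indicator hG hφ]
  refine Finset.sum_congr rfl fun q hq => ?_
  rw [sum_encoding_x, inter_inter_of_subset (pair_subset_of_mem_pairsOf hq),
    inter_inter_of_subset (bdPlus_subset_of_mem_pairsOf hq)]
  refine if_congr (and_congr_right fun hr => ?_) rfl rfl
  -- Amenability makes the membership condition in `𝒜⁺` automatic for relevant nodes.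
  exact (and_iff_right (inside_inter_mem_APlusSet hC hr)).symm

theorem encoding_lift (hG : ∀ s : V, 2 ≤ (G.faceVerts s).card) (hφ : T.IsForcing φ)
    (hC : T.AmenableForced Z φ C) (p : P) {s t : V} (hne : (T.pairsOf G p s t).Nonempty)
    (W : Finset V) :
    (T.encoding G φ C.inside).x {p} W =
      ∑ q ∈ T.pairsOf G p s t,
        ∑ S : Finset V with S ∈ T.APlusSet G Z q ∧ S ∩ T.bdPlus G p = W,
          (T.encoding G φ C.inside).x q S := by
  -- Inserting the true conjunct `hne` gives the indicator the form of `sum_pairsOf_indicator`.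
  have h : (T.Relevant φ p ∧ C.inside ∩ T.bdPlus G p = W) =
      (T.Relevant φ p ∧ (T.pairsOf G p s t).Nonempty ∧ C.inside ∩ T.bdPlus G p = W) := by
    simp only [hne, true_and]
  simp only [encoding_x_singleton, h]
  rw [← sum_pairsOf_indicator hG hφ]
  refine Finset.sum_congr rfl fun q hq => ?_
  rw [sum_encoding_x, inter_inter_of_subset (bdPlus_subset_of_mem_pairsOf hq)]
  refine if_congr (and_congr_right fun hr => ?_) rfl rfl
  exact (and_iff_right (inside_inter_mem_APlusSet hC hr)).symm

theorem encoding_marginals (U : Finset V) (p : P) {s t : V} (hst : s ≠ t)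
    (hne : (T.pairsOf G p s t).Nonempty) (D' W : Finset V) :
    (T.encoding G φ U).z p s D' W =
      ∑ E ∈ ({s, t} : Finset V).powerset with E ∩ {s} = D',
        (T.encoding G φ U).y p {s, t} E W := by
  have hnode : (T.nodesOf G p s).Nonempty := by
    obtain ⟨q, hq⟩ := hne
    obtain ⟨ps, pt, -, hs, -, h⟩ := (T.mem_pairsOf G).1 hq
    exact ⟨ps, (T.mem_nodesOf G).2 ⟨h.1, hs⟩⟩
  have hsub : U ∩ {s, t} ∩ {s} = U ∩ {s} := inter_inter_of_subset (by simp)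
  simp only [encoding_y_pair _ _ hst]
  symm
  apply sum_indicator_of_unique
  · rintro ⟨hr, -, h1, h2⟩
    -- The only `E` with a nonzero value is the trace of `U` on the pair.
    refine ⟨U ∩ {s, t}, ?_, ⟨hr, hne, rfl, h2⟩, fun E _ hE => hE.2.2.1.symm⟩
    rw [Finset.mem_filter, Finset.mem_powerset]
    exact ⟨Finset.inter_subset_right, hsub.trans h1⟩
  · rintro E hE ⟨hr, -, rfl, h2⟩
    exact ⟨hr, hnode, hsub.symm.trans (Finset.mem_filter.1 hE).2, h2⟩

theorem encoding_separated (hG : ∀ s : V, 2 ≤ (G.faceVerts s).card) (hφ : T.IsForcing φ)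
    (hC : T.AmenableForced Z φ C) {s t : V} (hst : s ≠ t) :
    (T.encoding G φ C.inside).ysep {s, t} =
      ∑ p : P, ∑ E ∈ ({s, t} : Finset V).powerset with (E ∩ {s, t}).card = 1,
        ∑ W : Finset V with W ∈ T.APlus G Z p, (T.encoding G φ C.inside).y p {s, t} E W := by
  have hinner : ∀ p, ∑ E ∈ ({s, t} : Finset V).powerset with (E ∩ {s, t}).card = 1,
      ∑ W : Finset V with W ∈ T.APlus G Z p, (T.encoding G φ C.inside).y p {s, t} E W =
        if T.Relevant φ p ∧ (T.pairsOf G p s t).Nonempty ∧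
          (C.inside ∩ {s, t}).card = 1 then 1 else 0 := by
    intro p
    simp only [encoding_y_pair _ _ hst, ← and_assoc, sum_filter_indicator]
    have hself : C.inside ∩ {s, t} ∩ {s, t} = C.inside ∩ {s, t} :=
      inter_inter_of_subset subset_rfl
    apply sum_indicator_of_unique
    · rintro ⟨⟨hr, hne⟩, h1⟩
      refine ⟨C.inside ∩ {s, t}, ?_, ⟨⟨⟨hr, hne⟩, rfl⟩, inside_inter_mem_APlus hC hr⟩,
        fun E _ hE => hE.1.2.symm⟩
      rw [Finset.mem_filter, Finset.mem_powerset, hself]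
      exact ⟨Finset.inter_subset_right, h1⟩
    · rintro E hE ⟨⟨hr, rfl⟩, -⟩
      exact ⟨hr, hself ▸ (Finset.mem_filter.1 hE).2⟩
  rw [Finset.sum_congr rfl fun p _ => hinner p]
  symm
  apply sum_indicator_of_unique
  · intro h1
    obtain ⟨ps, ⟨-, hrs, hs⟩, -⟩ := relevant_root.exists_unique_node (s := s) hG hφ T.root
      (T.ground_root ▸ Finset.subset_univ _)
    obtain ⟨pt, ⟨-, hrt, ht⟩, -⟩ := relevant_root.exists_unique_node (s := t) hG hφ T.root
      (T.ground_root ▸ Finset.subset_univ _)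
    obtain ⟨m, hm⟩ := hrs.exists_isLCA hrt
    refine ⟨m, Finset.mem_univ _, ⟨hrs.of_anc hm.1,
      ⟨_, (T.mem_pairsOf G).2 ⟨ps, pt, rfl, hs, ht, hm⟩⟩, h1⟩, ?_⟩
    -- Another contributing node would be the lowest common ancestor of a relevant pair for `s, t`,
    -- but there is only one such pair.
    rintro m' - ⟨hr, hne, -⟩
    obtain ⟨ps', pt', hrs', hrt', hs', ht', hm'⟩ := hr.exists_pair hG hφ hne
    obtain rfl := hrs'.node_eq hG hφ hrs hs' hs
    obtain rfl := hrt'.node_eq hG hφ hrt ht' ht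
    exact Sum.inl.inj (hm'.unique hm)
  · exact fun p _ h => h.2.2

theorem encoding_demand (I : CutInstance V) (U : Finset V) :
    ∑ e : Finset V with e.card = 2, I.demand e * (T.encoding G φ U).ysep e =
      I.cutDemand U := by
  simp only [encoding, CutInstance.cutDemand, mul_ite, mul_one, mul_zero]
  rw [← Finset.sum_filter, Finset.filter_filter]

theorem lpCost_encoding (I : CutInstance V) (U : Finset V) :
    lpCost G I (T.encoding G φ U) = I.cutCost G U := by
  simp only [lpCost, encoding, CutInstance.cutCost, mul_ite, mul_one, mul_zero]
  rw [← Finset.sum_filter, Finset.filter_filter]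

theorem encoding_x_mem_unit (U : Finset V) (q : Finset P) (S : Finset V) :
    0 ≤ (T.encoding G φ U).x q S ∧ (T.encoding G φ U).x q S ≤ 1 := by
  simp only [encoding]
  split_ifs <;> norm_num

theorem encoding_feasible (hG : ∀ s : V, 2 ≤ (G.faceVerts s).card) (hφ : T.IsForcing φ)
    (hC : T.AmenableForced Z φ C) (I : CutInstance V) {α : ℝ} (hα : α ≤ I.cutDemand C.inside) :
    T.LPFeasible G I Z α (T.encoding G φ C.inside) where
  x_single p S _ := encoding_x_mem_unit _ _ _
  x_pair p p' m _ _ S _ := encoding_x_mem_unit _ _ _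
  root := by
    rw [encoding_x_singleton, T.bdPlus_root, Finset.inter_empty]
    simp [relevant_root]
  assign c hc S _ := encoding_assign hφ hC hc S
  proj_z p s D' _ W _ := encoding_proj_z hG hφ hC p s D' W
  proj_y p s t hst D' _ W _ := encoding_proj_y hG hφ hC p hst D' W
  marginals p s t hst hne D' _ W _ := encoding_marginals _ p hst hne D' W
  separated s t hst := encoding_separated hG hφ hC hst
  lift p s t _ hne W _ := encoding_lift hG hφ hC p hne W
  demand := hα.trans_eq (encoding_demand I _).symm

end Encoding

end Decomposition

/-! ### Counting and choosing the guesses for the separated demand -/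

section Guesses

theorem two_le_card_of_cutDemand_pos {V : Type u} [Fintype V] (I : CutInstance V)
    {U : Finset V} (h : 0 < I.cutDemand U) : 2 ≤ Fintype.card V := by
  by_contra hlt
  refine h.ne' (Finset.sum_eq_zero fun e he => ?_)
  have := (Finset.mem_filter.1 he).2.1
  have := Finset.card_le_univ e
  omega

theorem half_le_log_one_add {ε : ℝ} (h0 : 0 < ε) (h1 : ε ≤ 1) : ε / 2 ≤ Real.log (1 + ε) := by
  -- The lower bound `1 - 1 / (1 + ε) = ε / (1 + ε)` is at least `ε / 2` since `ε ≤ 1`.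
  have h := Real.one_sub_inv_le_log_of_pos (show 0 < 1 + ε by linarith)
  refine le_trans ?_ h
  rw [div_le_iff₀ two_pos]
  have : (1 + ε)⁻¹ * (1 + ε) = 1 := inv_mul_cancel₀ (by linarith)
  have hpos : 0 < (1 + ε)⁻¹ := by positivity
  nlinarith

/-- Taking logarithms in `(1 + ε) ^ i ≤ n ^ 5` gives `i * ε / 2 ≤ 5 * log n`, whence the factor
`10`. -/
theorem guesses_subset {n : ℕ} {ε : ℝ} (h0 : 0 < ε) (h1 : ε ≤ 1) :
    guesses n ε ⊆ (fun i : ℕ => (1 + ε) ^ i) ''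
      (Finset.range (⌊10 * ε⁻¹ * Real.log n⌋₊ + 1) : Set ℕ) := by
  rintro α ⟨⟨i, rfl⟩, -, hi⟩
  refine ⟨i, ?_, rfl⟩
  rw [Finset.coe_range, Set.mem_Iio, Nat.lt_succ_iff]
  apply Nat.le_floor
  have hlog := Real.log_le_log (by positivity) hi
  rw [Real.log_pow, Real.log_pow] at hlog
  have hhalf := mul_le_mul_of_nonneg_left (half_le_log_one_add h0 h1) (Nat.cast_nonneg (α := ℝ) i)
  push_cast at hlog
  have : (i : ℝ) * ε ≤ 10 * Real.log n := by linarith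
  rw [mul_right_comm, ← div_eq_mul_inv, le_div_iff₀ h0]
  exact this

theorem guesses_finite {n : ℕ} {ε : ℝ} (h0 : 0 < ε) (h1 : ε ≤ 1) :
    (guesses n ε).Finite :=
  ((Finset.finite_toSet _).image _).subset (guesses_subset h0 h1)

theorem guesses_ncard_le {n : ℕ} (hn : 2 ≤ n) {ε : ℝ} (h0 : 0 < ε) (h1 : ε ≤ 1) :
    ((guesses n ε).ncard : ℝ) ≤ 12 * ε⁻¹ * Real.log n := by
  have hcard : (guesses n ε).ncard ≤ ⌊10 * ε⁻¹ * Real.log n⌋₊ + 1 := by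
    refine (Set.ncard_le_ncard (guesses_subset h0 h1)
      ((Finset.finite_toSet _).image _)).trans ?_
    refine (Set.ncard_image_le (Finset.finite_toSet _)).trans ?_
    rw [Set.ncard_coe_finset, Finset.card_range]
  have hlog : 1 / 2 ≤ Real.log n := by
    have h2 : Real.log 2 ≤ Real.log n := Real.log_le_log two_pos (by exact_mod_cast hn)
    linarith [Real.log_two_gt_d9]
  have hinv : 1 ≤ ε⁻¹ := (one_le_inv₀ h0).2 h1
  have hfloor := Nat.floor_le (show 0 ≤ 10 * ε⁻¹ * Real.log n by positivity)
  -- The exponent `0` adds one to the count; `log n ≥ 1 / 2` and `ε⁻¹ ≥ 1` absorb it, turning `10`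
  -- into `12`.
  have hone : 1 ≤ 2 * (ε⁻¹ * Real.log n) := by nlinarith
  calc ((guesses n ε).ncard : ℝ) ≤ (⌊10 * ε⁻¹ * Real.log n⌋₊ : ℝ) + 1 := by exact_mod_cast hcard
    _ ≤ 12 * ε⁻¹ * Real.log n := by linarith

/-- A guess that underestimates `d` by a factor of at most `1 + ε`. -/
theorem exists_guess {n : ℕ} {ε d : ℝ} (h0 : 0 < ε) (hd : 1 ≤ d) (hdn : d ≤ (n : ℝ) ^ 5) :
    ∃ α ∈ guesses n ε, α ≤ d ∧ d ≤ (1 + ε) * α := by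
  obtain ⟨i, hi, hi'⟩ := exists_nat_pow_near hd (show 1 < 1 + ε by linarith)
  refine ⟨(1 + ε) ^ i, ⟨⟨i, rfl⟩, one_le_pow₀ (by linarith), hi.trans hdn⟩, hi, ?_⟩
  rw [← pow_succ']
  exact hi'.le

end Guesses

/-! ### From sparsity to cost, and the conclusion -/

theorem CutInstance.optSparsity_nonneg {D V F : Type u} [Fintype D] [Fintype V] [Fintype F]
    (I : CutInstance V) (G : PlaneGraph D V F) : 0 ≤ I.optSparsity G := by
  apply Real.sInf_nonneg
  rintro r ⟨U, hU, rfl⟩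
  exact div_nonneg (Finset.sum_nonneg fun e _ => I.cost_nonneg e) hU.le

/-- One factor `1 + ε` comes from near-optimal sparsity and one from rounding the demand; `ε² ≤ ε`
bounds their product by `1 + 3ε`. -/
theorem CutInstance.cutCost_le {D V F : Type u} [Fintype D] [Fintype V] [Fintype F]
    (I : CutInstance V) (G : PlaneGraph D V F) {U : Finset V} {ε α : ℝ} (h0 : 0 < ε)
    (h1 : ε ≤ 1) (hα : 0 ≤ α) (hU : 0 < I.cutDemand U)
    (hs : I.sparsity G U ≤ (1 + ε) * I.optSparsity G) (hd : I.cutDemand U ≤ (1 + ε) * α) :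
    I.cutCost G U ≤ (1 + 3 * ε) * α * I.optSparsity G := by
  have hopt := I.optSparsity_nonneg G
  rw [CutInstance.sparsity, div_le_iff₀ hU] at hs
  have hαopt : 0 ≤ α * I.optSparsity G := mul_nonneg hα hopt
  calc I.cutCost G U ≤ (1 + ε) * I.optSparsity G * I.cutDemand U := hs
    _ ≤ (1 + ε) * I.optSparsity G * ((1 + ε) * α) :=
        mul_le_mul_of_nonneg_left hd (by positivity)
    _ = (1 + 2 * ε + ε * ε) * (α * I.optSparsity G) := by ring
    _ ≤ (1 + 3 * ε) * (α * I.optSparsity G) :=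
        mul_le_mul_of_nonneg_right (by nlinarith) hαopt
    _ = (1 + 3 * ε) * α * I.optSparsity G := by ring

end PlanarSparsestCut

open PlanarSparsestCut in
theorem mainTheorem4 :
    ∃ K : ℝ, 0 < K ∧
      ∀ (D V F P Q : Type u) [Fintype D] [Fintype V] [Fintype F] [Fintype P] [Fintype Q]
        (G : PlaneGraph D V F) (I : CutInstance V) (T : Decomposition P Q F) (Z : ℕ) (ε : ℝ),
        (∀ s : V, 2 ≤ (G.faceVerts s).card) →
        I.Normalized →
        0 < ε → ε ≤ 1 →
        T.Friendly G I Z ε →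
        (guesses (Fintype.card V) ε).Finite ∧
        ((guesses (Fintype.card V) ε).ncard : ℝ) ≤ K * ε⁻¹ * Real.log (Fintype.card V) ∧
        ∃ α ∈ guesses (Fintype.card V) ε, ∃ (φ : Q → P) (C : G.DualCycle),
          T.IsFriendlyPair I Z ε φ C ∧
          T.LPFeasible G I Z α (T.encoding G φ C.inside) ∧
          lpCost G I (T.encoding G φ C.inside) ≤ (1 + K * ε) * α * I.optSparsity G := by
  -- The count of guesses needs `12`; the cost bound needs only `3`.
  refine ⟨12, by norm_num, ?_⟩
  intro D V F P Q _ _ _ _ _ G I T Z ε hG hnorm h0 h1 ⟨φ, C, hpair⟩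
  obtain ⟨hφ, hdem, hsp, hC⟩ := hpair
  have hn := two_le_card_of_cutDemand_pos I hdem
  obtain ⟨hd1, hdn⟩ := hnorm C.inside hdem
  obtain ⟨α, hα, hαd, hdα⟩ := exists_guess h0 hd1 hdn
  refine ⟨guesses_finite h0 h1, guesses_ncard_le hn h0 h1, α, hα, φ, C,
    ⟨hφ, hdem, hsp, hC⟩, Decomposition.encoding_feasible hG hφ hC I hαd, ?_⟩
  have hα0 : 0 ≤ α := zero_le_one.trans hα.2.1
  rw [Decomposition.lpCost_encoding]
  refine (I.cutCost_le G h0 h1 hα0 hdem hsp hdα).trans ?_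
  exact mul_le_mul_of_nonneg_right (mul_le_mul_of_nonneg_right (by linarith) hα0)
    (I.optSparsity_nonneg G)
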